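/- Let $N\ge 1$ and let $\mathcal H_S=\bigotimes_{k=1}^N\mathbb C^2$. For $A\in M_2(\mathbb C)$ let $A^{(k)}$ denote the operator on $\mathcal H_S$ that acts as $A$ on the $k$-th factor and as the identity on the others. Let $$\sigma_x=\begin{pmatrix}0&1\\1&0\end{pmatrix},\quad \sigma_y=\begin{pmatrix}0&-i\\i&0\end{pmatrix},\quad \sigma_z=\begin{pmatrix}1&0\\0&-1\end{pmatrix},\quad \sigma_+=\begin{pmatrix}0&1\\0&0\end{pmatrix},\quad \sigma_-=\begin{pmatrix}0&0\\1&0\end{pmatrix},\quad n_+=\begin{pmatrix}1&0\\0&0\end{pmatrix},\quad n_-=\begin{pmatrix}0&0\\0&1\end{pmatrix},$$ and let $$H_S=\sum_{k=1}^N\sigma_z^{(k)}+\sum_{k=1}^{N-1}\bigl(\sigma_x^{(k)}\sigma_x^{(k+1)}+\sigma_y^{(k)}\sigma_y^{(k+1)}\bigr).$$ For $\beta\in\mathbb R$ let $\rho_\beta=e^{-\beta\sigma_z}/\mathrm{Tr}(e^{-\beta\sigma_z})=\mathrm{diag}(\beta_0,\beta_1)$ and $\rho^\beta=\bigotimes_{i=1}^N\rho_\beta$.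 For $\beta,\beta'\in\mathbb R$, with $\rho_{\beta'}=\mathrm{diag}(\beta_0',\beta_1')$, let $\mathcal L^*$ be the generator of the quantum master equation of the chain coupled at its first and its $N$-th spin to heat baths at inverse temperatures $\beta$ and $\beta'$: $$\begin{aligned}\mathcal L^*(\rho)=-i[H_S,\rho]&+2\beta_0\bigl[2\sigma_+^{(1)}\rho\,\sigma_-^{(1)}-\{n_-^{(1)},\rho\}\bigr]+2\beta_1\bigl[2\sigma_-^{(1)}\rho\,\sigma_+^{(1)}-\{n_+^{(1)},\rho\}\bigr]\\&+2\beta_0'\bigl[2\sigma_+^{(N)}\rho\,\sigma_-^{(N)}-\{n_-^{(N)},\rho\}\bigr]+2\beta_1'\bigl[2\sigma_-^{(N)}\rho\,\sigma_+^{(N)}-\{n_+^{(N)},\rho\}\bigr].\end{aligned}$$ A state is a positive semidefinite operator $\rho$ on $\mathcal H_S$ with $\mathrm{Tr}\,\rho=1$; it is faithful if $\mathrm{Tr}(\rho A^*A)=0$ implies $A=0$, and stationary if $e^{t\mathcal L^*}\rho=\rho$ for all $t\ge 0$. **Theorem.** If $\beta=\beta'$, then $\rho^\beta$ is a faithful state,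 $\mathcal L^*(\rho^\beta)=0$, $\rho^\beta$ is stationary for the quantum dynamical semigroup $(e^{t\mathcal L^*})_{t\ge 0}$, and it is the unique stationary state of that semigroup; in particular it is its unique faithful stationary state. -/

import Mathlib

open scoped Matrix ComplexOrder

noncomputable section

namespace SpinChain

/-- Operators on one spin `ℂ²`. -/
abbrev Op1 : Type := Matrix (Fin 2) (Fin 2) ℂ

/-- Operators on `H_S = ⊗_{k=1}^N ℂ²`, as matrices in the product basis
`e_{s 1} ⊗ ⋯ ⊗ e_{s N}`, which is labelled by the functions `s : Fin N → Fin 2`. -/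
abbrev Op (N : ℕ) : Type := Matrix (Fin N → Fin 2) (Fin N → Fin 2) ℂ

def sigmaX : Op1 := !![0, 1; 1, 0]
def sigmaY : Op1 := !![0, -Complex.I; Complex.I, 0]
def sigmaZ : Op1 := !![1, 0; 0, -1]
def sigmaPlus : Op1 := !![0, 1; 0, 0]
def sigmaMinus : Op1 := !![0, 0; 1, 0]
def nPlus : Op1 := !![1, 0; 0, 0]
def nMinus : Op1 := !![0, 0; 0, 1]

/-- The tensor product `A 1 ⊗ ⋯ ⊗ A N` of one-spin operators, in the product basis. -/
def tensor {N : ℕ} (A : Fin N → Op1) : Op N :=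
  Matrix.of fun s t => ∏ j, A j (s j) (t j)

/-- `A^{(k)}`: the operator acting as `A` on the `k`-th spin and as the identity on all others.
The spins are numbered `1, …, N`; it is used only for `1 ≤ k ≤ N`. -/
def site (N k : ℕ) (A : Op1) : Op N :=
  tensor fun j : Fin N => if (j : ℕ) + 1 = k then A else 1

/-- The XY Hamiltonian
`H_S = ∑_{k=1}^N σ_z^{(k)} + ∑_{k=1}^{N-1} (σ_x^{(k)} σ_x^{(k+1)} + σ_y^{(k)} σ_y^{(k+1)})`. -/
def hamiltonian (N : ℕ) : Op N :=
  ∑ k ∈ Finset.Icc 1 N, site N k sigmaZ +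
    ∑ k ∈ Finset.Ico 1 N,
      (site N k sigmaX * site N (k + 1) sigmaX + site N k sigmaY * site N (k + 1) sigmaY)

/-- The one-spin equilibrium state `ρ_β = e^{-β σ_z} / Tr(e^{-β σ_z})`. -/
def gibbs (β : ℝ) : Op1 :=
  (Matrix.trace (NormedSpace.exp (-(β : ℂ) • sigmaZ)))⁻¹ •
    NormedSpace.exp (-(β : ℂ) • sigmaZ)

/-- `ρ^β = ρ_β ⊗ ⋯ ⊗ ρ_β`. -/
def productState (N : ℕ) (β : ℝ) : Op N :=
  tensor fun _ => gibbs β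

/-- The anticommutator `{A, B}`. -/
def anticomm {N : ℕ} (A B : Op N) : Op N := A * B + B * A

/-- The contribution of a bath at inverse temperature `β` attached to the `k`-th spin:
`2β₀ [2σ₊ρσ₋ - {n₋, ρ}] + 2β₁ [2σ₋ρσ₊ - {n₊, ρ}]`, all operators acting at the `k`-th spin,
where `β₀` and `β₁` are the diagonal entries of `ρ_β`. -/
def bathTerm (N k : ℕ) (β : ℝ) (ρ : Op N) : Op N :=
  (2 * gibbs β 0 0) •
      ((2 : ℂ) • (site N k sigmaPlus * ρ * site N k sigmaMinus)
        - anticomm (site N k nMinus) ρ) +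
    (2 * gibbs β 1 1) •
      ((2 : ℂ) • (site N k sigmaMinus * ρ * site N k sigmaPlus)
        - anticomm (site N k nPlus) ρ)

/-- The generator `ℒ*` of the quantum master equation `dρ/dt = ℒ*(ρ)` of the chain coupled at the
first spin to a bath at inverse temperature `β` and at the `N`-th spin to one at `β'`. -/
def masterGenerator (N : ℕ) (β β' : ℝ) : Op N →ₗ[ℂ] Op N where
  toFun ρ := -Complex.I • (hamiltonian N * ρ - ρ * hamiltonian N)
    + bathTerm N 1 β ρ + bathTerm N N β' ρ
  map_add' ρ τ := by
    simp only [bathTerm, anticomm, mul_add, add_mul, smul_add, smul_sub]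
    abel
  map_smul' c ρ := by
    simp only [bathTerm, anticomm, Matrix.mul_smul, Matrix.smul_mul, smul_add, smul_sub,
      smul_comm c, RingHom.id_apply]

theorem isTopologicalRing_of_normed (V : Type) [NormedAddCommGroup V] [NormedSpace ℂ V] :
    IsTopologicalRing (V →L[ℂ] V) :=
  inferInstance

/-- The algebra of superoperators, with its usual topology (that of the operator norm, for any norm
on the finite-dimensional space `Op N`), is a topological ring. -/
instance superoperator_isTopologicalRing (N : ℕ) : IsTopologicalRing (Op N →L[ℂ] Op N) :=
  isTopologicalRing_of_normed ((Fin N → Fin 2) → (Fin N → Fin 2) → ℂ)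

/-- The quantum dynamical semigroup `e^{t ℒ*}`, an exponential of bounded operators on the
finite-dimensional space `Op N`. -/
def semigroup (N : ℕ) (β β' : ℝ) (t : ℝ) : Op N →L[ℂ] Op N :=
  NormedSpace.exp ((t : ℂ) • LinearMap.toContinuousLinearMap (masterGenerator N β β'))

/-- States are density matrices. -/
def IsState {N : ℕ} (ρ : Op N) : Prop :=
  ρ.PosSemidef ∧ ρ.trace = 1

/-- The state `A ↦ Tr(ρ A)` is faithful: `Tr(ρ A* A) = 0` only for `A = 0`. -/
def IsFaithful {N : ℕ} (ρ : Op N) : Prop :=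
  ∀ A : Op N, (ρ * (Aᴴ * A)).trace = 0 → A = 0

/-- `ρ` is invariant under the semigroup `(e^{t ℒ*})_{t ≥ 0}`. -/
def IsStationary (N : ℕ) (β β' : ℝ) (ρ : Op N) : Prop :=
  ∀ t : ℝ, 0 ≤ t → semigroup N β β' t ρ = ρ

end SpinChain

end

/-!
A stationary `ρ` is one with `ℒ*(ρ) = 0` (`isStationary_iff`), so the theorem says that the kernel
of `ℒ*` is the line spanned by `σ = ρ^β`. The state `σ` is diagonal with positive entries, hence
invertible, and every operator can be written `σ X`. The argument tests `ℒ*(σ X) = 0` against `X*`.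

* Since `β₀ σ₊ σ = β₁ σ σ₊` and `β₁ σ₋ σ = β₀ σ σ₋` at each spin, `σ` commutes with the Hamiltonian,
  and the energy term `-i Tr (X* [H_S, σ X])` is purely imaginary (`trace_commutator_im`).
* By the same relations (detailed balance) each bath contributes minus twice
  `β₁ ‖[σ₊, X]‖² + β₀ ‖[σ₋, X]‖²`, with `‖Y‖² = Tr (Y* σ Y)` and `σ₊`, `σ₋` acting at the spin of the
  bath (`trace_bathTerm`).

Taking real parts, `ℒ*(σ X) = 0` forces `X` to commute with `σ₊` and `σ₋` at the first spin. The bath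
terms then vanish, so that `[H_S, X] = 0` as well. The commutant of `X` is thus a subalgebra
containing `H_S` and the operators at the first spin. Commutators with `H_S` move along the chain
(`siteHom_mem_of_hamiltonian_mem`), so it contains all one-spin operators, which generate the full
matrix algebra. Hence `X` is a scalar, and the trace fixes it. Taking `X = 1` in the same formulas
gives `ℒ*(σ) = 0`.
-/

namespace SpinChain

/-! ### Stationary vectors of a one-parameter semigroup -/

section Semigroup

variable {V : Type} [NormedAddCommGroup V] [NormedSpace ℂ V] [CompleteSpace V]

theorem hasDerivAt_exp_ofReal_smul_apply (L : V →L[ℂ] V) (v : V) (t : ℝ) :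
    HasDerivAt (fun u : ℝ => NormedSpace.exp ((u : ℂ) • L) v)
      (NormedSpace.exp ((t : ℂ) • L) (L v)) t := by
  have h : HasDerivAt (fun z : ℂ => NormedSpace.exp (z • L) v)
      (NormedSpace.exp ((t : ℂ) • L) (L v)) (t : ℂ) :=
    (ContinuousLinearMap.apply ℂ V v).hasFDerivAt.comp_hasDerivAt (t : ℂ)
      (hasDerivAt_exp_smul_const L (t : ℂ))
  simpa [Function.comp_def] using h.scomp t Complex.ofRealCLM.hasDerivAt

theorem exp_smul_apply_eq_self_iff (L : V →L[ℂ] V) (v : V) :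
    (∀ t : ℝ, 0 ≤ t → NormedSpace.exp ((t : ℂ) • L) v = v) ↔ L v = 0 := by
  constructor
  · intro h
    -- Invariance is known for `t ≥ 0` only, so the derivative at `0` is taken from the right.
    have h1 := (hasDerivAt_exp_ofReal_smul_apply L v 0).hasDerivWithinAt (s := Set.Ici 0)
    have h2 : HasDerivWithinAt (fun u : ℝ => NormedSpace.exp ((u : ℂ) • L) v) 0 (Set.Ici 0) 0 :=
      (hasDerivWithinAt_const (0 : ℝ) (Set.Ici (0 : ℝ)) v).congr (fun u hu => h u hu)
        (h 0 le_rfl)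
    simpa using (uniqueDiffWithinAt_Ici (0 : ℝ)).eq_deriv _ h1 h2
  · intro h t _
    have hd : ∀ u : ℝ, HasDerivAt (fun u : ℝ => NormedSpace.exp ((u : ℂ) • L) v) 0 u := by
      intro u
      simpa [h] using hasDerivAt_exp_ofReal_smul_apply L v u
    simpa using is_const_of_deriv_eq_zero (fun u => (hd u).differentiableAt)
      (fun u => (hd u).deriv) t 0

end Semigroup

/-- The superoperators on `Op N`, whose topology comes from no fixed norm, are identified with
those on the space of functions of two indices, a normed space with the same topology. -/
theorem isStationary_iff (N : ℕ) (β β' : ℝ) (ρ : Op N) :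
    IsStationary N β β' ρ ↔ masterGenerator N β β' ρ = 0 :=
  exp_smul_apply_eq_self_iff (V := (Fin N → Fin 2) → (Fin N → Fin 2) → ℂ)
    (LinearMap.toContinuousLinearMap (masterGenerator N β β')) ρ

/-! ### Tensor products of one-spin operators -/

section Tensor

variable {N : ℕ}

theorem tensor_apply (A : Fin N → Op1) (s t : Fin N → Fin 2) :
    tensor A s t = ∏ j, A j (s j) (t j) := rfl

theorem tensor_mul (A B : Fin N → Op1) : tensor A * tensor B = tensor (A * B) := by
  ext s t
  simp only [Matrix.mul_apply, tensor_apply, Pi.mul_apply, ← Finset.prod_mul_distrib]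
  rw [Finset.prod_univ_sum, Fintype.piFinset_univ]

theorem tensor_diagonal (d : Fin 2 → ℂ) :
    tensor (fun _ : Fin N => Matrix.diagonal d) = Matrix.diagonal fun s => ∏ j, d (s j) := by
  ext s t
  rw [tensor_apply]
  by_cases h : s = t
  · simp [h]
  · obtain ⟨j, hj⟩ := Function.ne_iff.1 h
    rw [Matrix.diagonal_apply_ne _ h]
    exact Finset.prod_eq_zero (Finset.mem_univ j) (Matrix.diagonal_apply_ne _ hj)

theorem tensor_one : tensor (1 : Fin N → Op1) = 1 := by
  have h := tensor_diagonal (N := N) (fun _ => 1)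
  simp only [Finset.prod_const_one, Matrix.diagonal_one] at h
  exact h

theorem tensor_single (s t : Fin N → Fin 2) :
    tensor (fun j => Matrix.single (s j) (t j) 1) = Matrix.single s t 1 := by
  ext u v
  rw [tensor_apply]
  by_cases h : s = u ∧ t = v
  · obtain ⟨rfl, rfl⟩ := h
    simp
  · rw [Matrix.single_apply, if_neg h]
    have : ∃ j, ¬ (s j = u j ∧ t j = v j) := by
      by_contra! h'
      exact h ⟨funext fun j => (h' j).1, funext fun j => (h' j).2⟩
    obtain ⟨j, hj⟩ := this
    exact Finset.prod_eq_zero (Finset.mem_univ j) (by rw [Matrix.single_apply, if_neg hj])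

theorem tensor_conjTranspose (A : Fin N → Op1) :
    (tensor A)ᴴ = tensor fun j => (A j)ᴴ := by
  ext s t
  simp [tensor_apply, Matrix.conjTranspose_apply]

theorem tensor_update_apply (B : Fin N → Op1) (i : Fin N) (A : Op1) (s t : Fin N → Fin 2) :
    tensor (Function.update B i A) s t =
      A (s i) (t i) * ∏ j ∈ Finset.univ.erase i, B j (s j) (t j) := by
  rw [tensor_apply, ← Finset.mul_prod_erase _ _ (Finset.mem_univ i), Function.update_self]
  congr 1
  refine Finset.prod_congr rfl fun j hj => ?_
  rw [Function.update_of_ne (Finset.ne_of_mem_erase hj)]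

theorem tensor_update_add (B : Fin N → Op1) (i : Fin N) (A A' : Op1) :
    tensor (Function.update B i (A + A')) =
      tensor (Function.update B i A) + tensor (Function.update B i A') := by
  ext s t
  simp only [Matrix.add_apply, tensor_update_apply, add_mul]

theorem tensor_update_smul (B : Fin N → Op1) (i : Fin N) (c : ℂ) (A : Op1) :
    tensor (Function.update B i (c • A)) = c • tensor (Function.update B i A) := by
  ext s t
  simp only [Matrix.smul_apply, tensor_update_apply, smul_eq_mul, mul_assoc]

/-- The embedding `A ↦ 1 ⊗ ⋯ ⊗ A ⊗ ⋯ ⊗ 1` of the one-spin operators at the spin `i`, as an algebra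
homomorphism. The index `i : Fin N` starts at `0`, so this is `A ↦ site N (i + 1) A`. -/
noncomputable def siteHom (i : Fin N) : Op1 →ₐ[ℂ] Op N :=
  AlgHom.ofLinearMap
    { toFun := fun A => tensor (Function.update 1 i A)
      map_add' := tensor_update_add 1 i
      map_smul' := tensor_update_smul 1 i }
    (by simp [tensor_one])
    (fun A B => by
      simp only [LinearMap.coe_mk, AddHom.coe_mk, tensor_mul]
      congr 1
      rw [← Function.update_mul, mul_one])

theorem siteHom_apply (i : Fin N) (A : Op1) : siteHom i A = tensor (Function.update 1 i A) := rfl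

theorem site_succ (i : Fin N) (A : Op1) : site N (i + 1) A = siteHom i A := by
  rw [siteHom_apply, site]
  congr 1
  funext j
  by_cases h : j = i
  · simp [h]
  · have h' : ¬ ((j : ℕ) + 1 = i + 1) := fun e => h (Fin.ext (by omega))
    rw [if_neg h', Function.update_of_ne h, Pi.one_apply]

theorem siteHom_mul_tensor (i : Fin N) (A : Op1) (B : Fin N → Op1) :
    siteHom i A * tensor B = tensor (Function.update B i (A * B i)) := by
  rw [siteHom_apply, tensor_mul]
  congr 1
  funext j
  by_cases h : j = i
  · subst h; simp
  · simp [h]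

theorem tensor_mul_siteHom (i : Fin N) (A : Op1) (B : Fin N → Op1) :
    tensor B * siteHom i A = tensor (Function.update B i (B i * A)) := by
  rw [siteHom_apply, tensor_mul]
  congr 1
  funext j
  by_cases h : j = i
  · subst h; simp
  · simp [h]

theorem siteHom_commute {i j : Fin N} (h : i ≠ j) (A B : Op1) :
    Commute (siteHom i A) (siteHom j B) := by
  show siteHom i A * siteHom j B = siteHom j B * siteHom i A
  rw [siteHom_apply j B, siteHom_mul_tensor, tensor_mul_siteHom]
  simp [Function.update_of_ne h]

theorem siteHom_conjTranspose (i : Fin N) (A : Op1) : (siteHom i A)ᴴ = siteHom i Aᴴ := by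
  rw [siteHom_apply, siteHom_apply, tensor_conjTranspose]
  congr 1
  funext j
  by_cases h : j = i
  · subst h; simp
  · simp [h]

theorem tensor_mem_of_forall_siteHom_mem {S : Subalgebra ℂ (Op N)}
    (hS : ∀ i A, siteHom i A ∈ S) (A : Fin N → Op1) : tensor A ∈ S := by
  have key : ∀ T : Finset (Fin N), tensor (T.piecewise A 1) ∈ S := by
    intro T
    induction T using Finset.induction_on with
    | empty => simp [tensor_one]
    | insert i T hi ih =>
      have h := S.mul_mem (hS i (A i)) ih
      rwa [siteHom_mul_tensor, Finset.piecewise_eq_of_notMem _ _ _ hi, Pi.one_apply, mul_one,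
        ← Finset.piecewise_insert] at h
  simpa using key Finset.univ

/-- The one-spin operators generate the whole algebra, so that their commutant is trivial. -/
theorem exists_eq_smul_one_of_forall_commute_siteHom {X : Op N}
    (hX : ∀ i A, Commute (siteHom i A) X) : ∃ c : ℂ, X = c • (1 : Op N) := by
  have hmem : ∀ A : Fin N → Op1, tensor A ∈ Subalgebra.centralizer ℂ {X} :=
    tensor_mem_of_forall_siteHom_mem fun i A =>
      Subalgebra.mem_centralizer_iff ℂ |>.2 fun Y hY => by
        rw [Set.mem_singleton_iff.1 hY]; exact (hX i A).symm.eq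
  have h : X ∈ Set.range (Matrix.scalar (Fin N → Fin 2)) := by
    refine Matrix.mem_range_scalar_of_commute_single fun s t _ => ?_
    have h := hmem fun j => Matrix.single (s j) (t j) 1
    rw [tensor_single, Subalgebra.mem_centralizer_iff] at h
    exact (h X rfl).symm
  obtain ⟨c, rfl⟩ := h
  exact ⟨c, by rw [Matrix.scalar_apply, Matrix.smul_one_eq_diagonal]⟩

end Tensor

/-! ### The equilibrium state -/

/-- The diagonal entries `β₀` and `β₁` of the one-spin equilibrium state, as real numbers. -/
noncomputable def gibbsWeight (β : ℝ) : Fin 2 → ℝ :=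
  ![Real.exp (-β) / (Real.exp (-β) + Real.exp β), Real.exp β / (Real.exp (-β) + Real.exp β)]

theorem gibbsWeight_pos (β : ℝ) (a : Fin 2) : 0 < gibbsWeight β a := by
  fin_cases a <;> simp [gibbsWeight] <;> positivity

theorem sum_gibbsWeight (β : ℝ) : ∑ a, gibbsWeight β a = 1 := by
  have h : 0 < Real.exp (-β) + Real.exp β := by positivity
  simp only [Fin.sum_univ_two, gibbsWeight, Matrix.cons_val_zero, Matrix.cons_val_one]
  field_simp

theorem gibbs_eq_diagonal (β : ℝ) : gibbs β = Matrix.diagonal fun a => (gibbsWeight β a : ℂ) := by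
  have hz : -(β : ℂ) • sigmaZ = Matrix.diagonal ![-(β : ℂ), (β : ℂ)] := by
    ext a b
    fin_cases a <;> fin_cases b <;> simp [sigmaZ]
  have hE : NormedSpace.exp (-(β : ℂ) • sigmaZ) =
      Matrix.diagonal ![Complex.exp (-β), Complex.exp β] := by
    rw [hz, Matrix.exp_diagonal]
    congr 1
    rw [Pi.exp_def]
    funext a
    fin_cases a <;> simp [Complex.exp_eq_exp_ℂ]
  rw [gibbs, hE]
  ext a b
  fin_cases a <;> fin_cases b <;> simp [gibbsWeight, Matrix.trace, Fin.sum_univ_two] <;> ring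

/-- The (strictly positive) eigenvalues of the product state `ρ^β`. -/
noncomputable def productWeight {N : ℕ} (β : ℝ) (s : Fin N → Fin 2) : ℝ := ∏ j, gibbsWeight β (s j)

theorem productWeight_pos {N : ℕ} (β : ℝ) (s : Fin N → Fin 2) : 0 < productWeight β s :=
  Finset.prod_pos fun _ _ => gibbsWeight_pos β _

theorem sum_productWeight (N : ℕ) (β : ℝ) : ∑ s : Fin N → Fin 2, productWeight β s = 1 := by
  have h := Finset.prod_univ_sum (fun _ : Fin N => (Finset.univ : Finset (Fin 2)))
    (fun _ a => gibbsWeight β a)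
  rw [Fintype.piFinset_univ] at h
  simp only [productWeight, ← h, sum_gibbsWeight, Finset.prod_const_one]

theorem productState_eq_diagonal (N : ℕ) (β : ℝ) :
    productState N β = Matrix.diagonal fun s => (productWeight β s : ℂ) := by
  rw [productState, gibbs_eq_diagonal, tensor_diagonal]
  simp [productWeight]

theorem productState_conjTranspose (N : ℕ) (β : ℝ) :
    (productState N β)ᴴ = productState N β := by
  rw [productState_eq_diagonal, Matrix.diagonal_conjTranspose]
  congr 1
  funext s
  simp

theorem productState_isState (N : ℕ) (β : ℝ) : IsState (productState N β) := by
  rw [productState_eq_diagonal]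
  refine ⟨Matrix.PosSemidef.diagonal fun s => ?_, ?_⟩
  · exact Complex.zero_le_real.2 (productWeight_pos β s).le
  · rw [Matrix.trace_diagonal, ← Complex.ofReal_sum, sum_productWeight, Complex.ofReal_one]

theorem isUnit_productState (N : ℕ) (β : ℝ) : IsUnit (productState N β) := by
  rw [productState_eq_diagonal, Matrix.isUnit_diagonal, Pi.isUnit_iff]
  exact fun s => isUnit_iff_ne_zero.2 (Complex.ofReal_ne_zero.2 (productWeight_pos β s).ne')

/-- The square of the weighted `L²` norm: `Tr (Y* ρ^β Y)`, written out in matrix entries. -/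
noncomputable def weightedNormSq {N : ℕ} (β : ℝ) (Y : Op N) : ℝ :=
  ∑ t, ∑ s, productWeight β s * Complex.normSq (Y s t)

theorem trace_conjTranspose_mul_productState_mul {N : ℕ} (β : ℝ) (Y : Op N) :
    (Yᴴ * productState N β * Y).trace = (weightedNormSq β Y : ℂ) := by
  rw [productState_eq_diagonal, weightedNormSq, Matrix.trace, Complex.ofReal_sum]
  refine Finset.sum_congr rfl fun t _ => ?_
  rw [Matrix.diag_apply, Matrix.mul_apply, Complex.ofReal_sum]
  refine Finset.sum_congr rfl fun s _ => ?_
  rw [Matrix.mul_diagonal, Matrix.conjTranspose_apply, Complex.ofReal_mul,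
    Complex.normSq_eq_conj_mul_self, starRingEnd_apply]
  ring

theorem weightedNormSq_nonneg {N : ℕ} (β : ℝ) (Y : Op N) : 0 ≤ weightedNormSq β Y :=
  Finset.sum_nonneg fun _ _ => Finset.sum_nonneg fun s _ =>
    mul_nonneg (productWeight_pos β s).le (Complex.normSq_nonneg _)

theorem weightedNormSq_eq_zero {N : ℕ} {β : ℝ} {Y : Op N} (h : weightedNormSq β Y = 0) :
    Y = 0 := by
  have hnn : ∀ s t, 0 ≤ productWeight β s * Complex.normSq (Y s t) := fun s t =>
    mul_nonneg (productWeight_pos β s).le (Complex.normSq_nonneg _)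
  ext s t
  have h1 := (Finset.sum_eq_zero_iff_of_nonneg fun t _ =>
    Finset.sum_nonneg fun s _ => hnn s t).1 h t (Finset.mem_univ t)
  have h2 := (Finset.sum_eq_zero_iff_of_nonneg fun s _ => hnn s t).1 h1 s (Finset.mem_univ s)
  exact Complex.normSq_eq_zero.1 ((mul_eq_zero.1 h2).resolve_left (productWeight_pos β s).ne')

theorem productState_isFaithful (N : ℕ) (β : ℝ) : IsFaithful (productState N β) := by
  intro A hA
  have h : (Aᴴᴴ * productState N β * Aᴴ).trace = 0 := by
    rw [Matrix.conjTranspose_conjTranspose, mul_assoc, Matrix.trace_mul_comm, mul_assoc, hA]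
  rw [trace_conjTranspose_mul_productState_mul, Complex.ofReal_eq_zero] at h
  exact Matrix.conjTranspose_eq_zero.1 (weightedNormSq_eq_zero h)

/-! ### Commutation of the equilibrium state with one-spin operators -/

section Commutation

variable {N : ℕ} (β : ℝ) (i : Fin N)

theorem productState_mul_siteHom (A : Op1) :
    productState N β * siteHom i A =
      tensor (Function.update (fun _ => gibbs β) i (gibbs β * A)) :=
  tensor_mul_siteHom i A _

theorem siteHom_mul_productState (A : Op1) :
    siteHom i A * productState N β =
      tensor (Function.update (fun _ => gibbs β) i (A * gibbs β)) :=
  siteHom_mul_tensor i A _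

/-- Together with `smul_sigmaMinus_mul_productState` this is the detailed balance of the baths; it
is stated without division. -/
theorem smul_sigmaPlus_mul_productState :
    (gibbsWeight β 0 : ℂ) • (siteHom i sigmaPlus * productState N β) =
      (gibbsWeight β 1 : ℂ) • (productState N β * siteHom i sigmaPlus) := by
  rw [productState_mul_siteHom, siteHom_mul_productState, ← tensor_update_smul,
    ← tensor_update_smul]
  congr 2
  rw [gibbs_eq_diagonal]
  ext a b
  fin_cases a <;> fin_cases b <;> simp [sigmaPlus, Matrix.vecMul_diagonal, mul_comm]

theorem smul_sigmaMinus_mul_productState :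
    (gibbsWeight β 1 : ℂ) • (siteHom i sigmaMinus * productState N β) =
      (gibbsWeight β 0 : ℂ) • (productState N β * siteHom i sigmaMinus) := by
  rw [productState_mul_siteHom, siteHom_mul_productState, ← tensor_update_smul,
    ← tensor_update_smul]
  congr 2
  rw [gibbs_eq_diagonal]
  ext a b
  fin_cases a <;> fin_cases b <;> simp [sigmaMinus, Matrix.vecMul_diagonal, mul_comm]

theorem commute_siteHom_sigmaZ_productState :
    Commute (siteHom i sigmaZ) (productState N β) := by
  show _ * _ = _ * _
  rw [productState_mul_siteHom, siteHom_mul_productState]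
  congr 2
  rw [gibbs_eq_diagonal]
  ext a b
  fin_cases a <;> fin_cases b <;> simp [sigmaZ]

end Commutation

/-! ### Dissipation by a bath -/

section Bath

variable {N : ℕ} (β : ℝ) (i : Fin N)

theorem sigmaPlus_mul_sigmaMinus : sigmaPlus * sigmaMinus = nPlus := by
  ext a b
  fin_cases a <;> fin_cases b <;> simp [sigmaPlus, sigmaMinus, nPlus]

theorem sigmaMinus_mul_sigmaPlus : sigmaMinus * sigmaPlus = nMinus := by
  ext a b
  fin_cases a <;> fin_cases b <;> simp [sigmaPlus, sigmaMinus, nMinus]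

theorem sigmaPlus_conjTranspose : sigmaPlusᴴ = sigmaMinus := by
  ext a b
  fin_cases a <;> fin_cases b <;> simp [sigmaPlus, sigmaMinus]

theorem sigmaMinus_conjTranspose : sigmaMinusᴴ = sigmaPlus := by
  rw [← sigmaPlus_conjTranspose, Matrix.conjTranspose_conjTranspose]

/-- Half of the map `X ↦ σ⁻¹ 𝓑(σ X)`, where `𝓑` is the bath generator at the spin `i` and `σ` the
equilibrium state; see `bathTerm_productState_mul`. -/
noncomputable def bathDual (X : Op N) : Op N :=
  let p := siteHom i sigmaPlus
  let m := siteHom i sigmaMinus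
  (gibbsWeight β 1 : ℂ) • ((2 : ℂ) • (p * X * m) - p * m * X - X * p * m) +
    (gibbsWeight β 0 : ℂ) • ((2 : ℂ) • (m * X * p) - m * p * X - X * m * p)

theorem bathTerm_productState_mul (X : Op N) :
    bathTerm N (i + 1) β (productState N β * X) =
      (2 : ℂ) • (productState N β * bathDual β i X) := by
  have hp := smul_sigmaPlus_mul_productState β i
  have hm := smul_sigmaMinus_mul_productState β i
  simp only [bathTerm, anticomm, bathDual, site_succ, ← sigmaPlus_mul_sigmaMinus,
    ← sigmaMinus_mul_sigmaPlus, map_mul, gibbs_eq_diagonal, Matrix.diagonal_apply_eq]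
  generalize siteHom i sigmaPlus = p at *
  generalize siteHom i sigmaMinus = m at *
  generalize productState N β = σ at *
  generalize (gibbsWeight β 0 : ℂ) = b at *
  generalize (gibbsWeight β 1 : ℂ) = c at *
  -- Four of the six terms need `ρ^β` moved to the left end: the jump terms by `h1` and `h2`,
  -- the terms `m p ρ X` by `h3` and `h5`, the terms `p m ρ X` by `h4` and `h6`.
  have h1 := congrArg (· * (X * m)) hp
  have h2 := congrArg (· * (X * p)) hm
  have h3 := congrArg (m * · * X) hp
  have h4 := congrArg (p * · * X) hm
  have h5 := congrArg (· * (p * X)) hm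
  have h6 := congrArg (· * (m * X)) hp
  simp only [Matrix.smul_mul, Matrix.mul_smul, mul_assoc] at h1 h2 h3 h4 h5 h6
  simp only [mul_add, mul_sub, Matrix.mul_smul, mul_assoc]
  linear_combination (norm := module) (4 : ℂ) • h1 + (4 : ℂ) • h2 - (2 : ℂ) • h3 - (2 : ℂ) • h4
    - (2 : ℂ) • h5 - (2 : ℂ) • h6

/-- The Dirichlet form `β₁ ‖[σ₊, X]‖² + β₀ ‖[σ₋, X]‖²` of a bath at the spin `i`, in the weighted norm
`‖Y‖² = Tr (Y* ρ^β Y)`. -/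
noncomputable def dirichletForm (X : Op N) : ℝ :=
  gibbsWeight β 1 *
      weightedNormSq β (siteHom i sigmaPlus * X - X * siteHom i sigmaPlus) +
    gibbsWeight β 0 *
      weightedNormSq β (siteHom i sigmaMinus * X - X * siteHom i sigmaMinus)

/-- The dissipation identity: tested against `X*`, a bath generator is minus twice its Dirichlet
form. In particular it is real and nonpositive. -/
theorem trace_bathTerm (X : Op N) :
    (Xᴴ * bathTerm N (i + 1) β (productState N β * X)).trace =
      ((-2 * dirichletForm β i X : ℝ) : ℂ) := by
  rw [bathTerm_productState_mul]
  push_cast [dirichletForm]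
  have hp := smul_sigmaPlus_mul_productState β i
  have hm := smul_sigmaMinus_mul_productState β i
  simp only [← trace_conjTranspose_mul_productState_mul, bathDual, Matrix.conjTranspose_sub,
    Matrix.conjTranspose_mul, siteHom_conjTranspose, sigmaPlus_conjTranspose,
    sigmaMinus_conjTranspose]
  generalize siteHom i sigmaPlus = p at *
  generalize siteHom i sigmaMinus = m at *
  generalize productState N β = σ at *
  generalize (gibbsWeight β 0 : ℂ) = b at *
  generalize (gibbsWeight β 1 : ℂ) = c at *
  -- `h1`–`h4` move `ρ^β` next to `X*`; `c1`–`c4` move the leading factor of the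
  -- terms `m X* ⋯` and `p X* ⋯` to the right by cyclicity of the trace.
  have h1 := congrArg (fun Z => (Xᴴ * Z * (p * X)).trace) hm
  have h2 := congrArg (fun Z => (Xᴴ * Z * (X * p)).trace) hm
  have h3 := congrArg (fun Z => (Xᴴ * Z * (m * X)).trace) hp
  have h4 := congrArg (fun Z => (Xᴴ * Z * (X * m)).trace) hp
  have c1 := Matrix.trace_mul_comm m (Xᴴ * σ * p * X)
  have c2 := Matrix.trace_mul_comm m (Xᴴ * σ * X * p)
  have c3 := Matrix.trace_mul_comm p (Xᴴ * σ * m * X)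
  have c4 := Matrix.trace_mul_comm p (Xᴴ * σ * X * m)
  simp only [Matrix.smul_mul, Matrix.mul_smul, mul_assoc, Matrix.trace_smul, smul_eq_mul]
    at h1 h2 h3 h4 c1 c2 c3 c4
  simp only [mul_add, mul_sub, sub_mul, Matrix.mul_smul, mul_assoc, Matrix.trace_smul,
    Matrix.trace_sub, Matrix.trace_add, smul_eq_mul]
  linear_combination 2 * h1 - 2 * h2 + 2 * h3 - 2 * h4 - 2 * c * c1 + 2 * c * c2
    - 2 * b * c3 + 2 * b * c4

theorem dirichletForm_nonneg (X : Op N) : 0 ≤ dirichletForm β i X :=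
  add_nonneg (mul_nonneg (gibbsWeight_pos β 1).le (weightedNormSq_nonneg β _))
    (mul_nonneg (gibbsWeight_pos β 0).le (weightedNormSq_nonneg β _))

variable {β i}

theorem commute_of_dirichletForm_eq_zero {X : Op N} (h : dirichletForm β i X = 0) :
    Commute (siteHom i sigmaPlus) X ∧ Commute (siteHom i sigmaMinus) X := by
  obtain ⟨h1, h2⟩ := (add_eq_zero_iff_of_nonneg
    (mul_nonneg (gibbsWeight_pos β 1).le (weightedNormSq_nonneg β _))
    (mul_nonneg (gibbsWeight_pos β 0).le (weightedNormSq_nonneg β _))).1 h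
  exact ⟨sub_eq_zero.1
      (weightedNormSq_eq_zero ((mul_eq_zero.1 h1).resolve_left (gibbsWeight_pos β 1).ne')),
    sub_eq_zero.1
      (weightedNormSq_eq_zero ((mul_eq_zero.1 h2).resolve_left (gibbsWeight_pos β 0).ne'))⟩

theorem bathTerm_eq_zero_of_commute {X : Op N} (hp : Commute (siteHom i sigmaPlus) X)
    (hm : Commute (siteHom i sigmaMinus) X) :
    bathTerm N (i + 1) β (productState N β * X) = 0 := by
  have h : bathDual β i X = 0 := by
    simp only [bathDual, hp.eq, hm.eq, (hp.mul_left hm).eq, (hm.mul_left hp).eq, ← mul_assoc]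
    module
  rw [bathTerm_productState_mul, h, mul_zero, smul_zero]

end Bath

/-! ### The Hamiltonian -/

section Hamiltonian

variable {N : ℕ}

theorem exists_fin_of_mem_Icc {k : ℕ} (hk : k ∈ Finset.Icc 1 N) : ∃ i : Fin N, k = i + 1 := by
  rw [Finset.mem_Icc] at hk
  exact ⟨⟨k - 1, by omega⟩, by simp; omega⟩

theorem exists_fin_of_mem_Ico {k : ℕ} (hk : k ∈ Finset.Ico 1 N) :
    ∃ i j : Fin N, (j : ℕ) = i + 1 ∧ k = i + 1 := by
  rw [Finset.mem_Ico] at hk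
  exact ⟨⟨k - 1, by omega⟩, ⟨k, hk.2⟩, by simp; omega, by simp; omega⟩

/-- The nearest-neighbour coupling of the spins `i` and `j`. -/
noncomputable def link (i j : Fin N) : Op N :=
  siteHom i sigmaX * siteHom j sigmaX + siteHom i sigmaY * siteHom j sigmaY

theorem site_link {i j : Fin N} (h : (j : ℕ) = i + 1) :
    site N (i + 1) sigmaX * site N (i + 1 + 1) sigmaX +
      site N (i + 1) sigmaY * site N (i + 1 + 1) sigmaY = link i j := by
  rw [← h, site_succ, site_succ, h, site_succ, site_succ, link]

theorem sigmaX_eq : sigmaX = sigmaPlus + sigmaMinus := by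
  ext a b
  fin_cases a <;> fin_cases b <;> simp [sigmaX, sigmaPlus, sigmaMinus]

theorem sigmaY_eq : sigmaY = -Complex.I • (sigmaPlus - sigmaMinus) := by
  ext a b
  fin_cases a <;> fin_cases b <;> simp [sigmaY, sigmaPlus, sigmaMinus]

/-- The coupling moves one excitation between the two spins and so conserves their number; this is
why it commutes with the product state. -/
theorem link_eq_hopping (i j : Fin N) :
    link i j = (2 : ℂ) • (siteHom i sigmaPlus * siteHom j sigmaMinus +
      siteHom i sigmaMinus * siteHom j sigmaPlus) := by
  rw [link, sigmaX_eq, sigmaY_eq, map_smul, map_smul, Matrix.smul_mul, Matrix.mul_smul, smul_smul,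
    neg_mul_neg, Complex.I_mul_I]
  simp only [map_add, map_sub, mul_add, add_mul, mul_sub, sub_mul]
  module

theorem commute_hopping_productState (β : ℝ) (i j : Fin N) :
    Commute (siteHom i sigmaPlus * siteHom j sigmaMinus) (productState N β) := by
  have hp := congrArg (· * siteHom j sigmaMinus) (smul_sigmaPlus_mul_productState β i)
  have hm := congrArg (siteHom i sigmaPlus * ·) (smul_sigmaMinus_mul_productState β j)
  simp only [Matrix.smul_mul, Matrix.mul_smul, mul_assoc] at hp hm
  -- The factors picked up at `i` and at `j` are inverse to each other.
  have hc : (gibbsWeight β 1 : ℂ) ≠ 0 := Complex.ofReal_ne_zero.2 (gibbsWeight_pos β 1).ne'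
  refine smul_right_injective _ hc ?_
  simp only [mul_assoc, hm, hp]

theorem commute_link_productState (β : ℝ) {i j : Fin N} (h : i ≠ j) :
    Commute (link i j) (productState N β) := by
  rw [link_eq_hopping, (siteHom_commute h sigmaMinus sigmaPlus).eq]
  exact ((commute_hopping_productState β i j).add_left
    (commute_hopping_productState β j i)).smul_left 2

theorem commute_hamiltonian_productState (N : ℕ) (β : ℝ) :
    Commute (hamiltonian N) (productState N β) := by
  refine Commute.add_left (Commute.sum_left _ _ _ fun k hk => ?_)
    (Commute.sum_left _ _ _ fun k hk => ?_)
  · obtain ⟨i, rfl⟩ := exists_fin_of_mem_Icc hk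
    rw [site_succ]
    exact commute_siteHom_sigmaZ_productState β i
  · obtain ⟨i, j, hij, rfl⟩ := exists_fin_of_mem_Ico hk
    rw [site_link hij]
    exact commute_link_productState β fun e => by simp [e] at hij

theorem sigmaX_conjTranspose : sigmaXᴴ = sigmaX := by
  ext a b
  fin_cases a <;> fin_cases b <;> simp [sigmaX]

theorem sigmaY_conjTranspose : sigmaYᴴ = sigmaY := by
  ext a b
  fin_cases a <;> fin_cases b <;> simp [sigmaY]

theorem sigmaZ_conjTranspose : sigmaZᴴ = sigmaZ := by
  ext a b
  fin_cases a <;> fin_cases b <;> simp [sigmaZ]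

theorem link_conjTranspose {i j : Fin N} (h : i ≠ j) : (link i j)ᴴ = link i j := by
  simp only [link, Matrix.conjTranspose_add, Matrix.conjTranspose_mul, siteHom_conjTranspose,
    sigmaX_conjTranspose, sigmaY_conjTranspose, (siteHom_commute h _ _).eq]

theorem hamiltonian_conjTranspose (N : ℕ) : (hamiltonian N)ᴴ = hamiltonian N := by
  rw [hamiltonian, Matrix.conjTranspose_add, Matrix.conjTranspose_sum, Matrix.conjTranspose_sum]
  congr 1
  · refine Finset.sum_congr rfl fun k hk => ?_
    obtain ⟨i, rfl⟩ := exists_fin_of_mem_Icc hk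
    rw [site_succ, siteHom_conjTranspose, sigmaZ_conjTranspose]
  · refine Finset.sum_congr rfl fun k hk => ?_
    obtain ⟨i, j, hij, rfl⟩ := exists_fin_of_mem_Ico hk
    rw [site_link hij, link_conjTranspose fun e => by simp [e] at hij]

/-! ### Propagation along the chain -/

theorem siteHom_mem_of_sigmaPlus_mem_of_sigmaMinus_mem {S : Subalgebra ℂ (Op N)} {i : Fin N}
    (hp : siteHom i sigmaPlus ∈ S) (hm : siteHom i sigmaMinus ∈ S) (A : Op1) :
    siteHom i A ∈ S := by
  have hA : A = A 0 0 • (sigmaPlus * sigmaMinus) + A 1 1 • (sigmaMinus * sigmaPlus) +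
      A 0 1 • sigmaPlus + A 1 0 • sigmaMinus := by
    rw [sigmaPlus_mul_sigmaMinus, sigmaMinus_mul_sigmaPlus]
    ext a b
    fin_cases a <;> fin_cases b <;> simp [sigmaPlus, sigmaMinus, nPlus, nMinus]
  rw [hA]
  simp only [map_add, map_smul, map_mul]
  exact S.add_mem (S.add_mem (S.add_mem (S.smul_mem (S.mul_mem hp hm) _)
    (S.smul_mem (S.mul_mem hm hp) _)) (S.smul_mem hp _)) (S.smul_mem hm _)

theorem siteHom_mem_of_sigmaX_mem_of_sigmaY_mem {S : Subalgebra ℂ (Op N)} {i : Fin N}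
    (hx : siteHom i sigmaX ∈ S) (hy : siteHom i sigmaY ∈ S) (A : Op1) : siteHom i A ∈ S := by
  have hp : sigmaPlus = (1 / 2 : ℂ) • (sigmaX + Complex.I • sigmaY) := by
    ext a b
    fin_cases a <;> fin_cases b <;> simp [sigmaPlus, sigmaX, sigmaY]
    norm_num
  have hm : sigmaMinus = (1 / 2 : ℂ) • (sigmaX - Complex.I • sigmaY) := by
    ext a b
    fin_cases a <;> fin_cases b <;> simp [sigmaMinus, sigmaX, sigmaY]
    norm_num
  refine siteHom_mem_of_sigmaPlus_mem_of_sigmaMinus_mem ?_ ?_ A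
  · rw [hp, map_smul, map_add, map_smul]
    exact S.smul_mem (S.add_mem hx (S.smul_mem hy _)) _
  · rw [hm, map_smul, map_sub, map_smul]
    exact S.smul_mem (S.sub_mem hx (S.smul_mem hy _)) _

theorem link_commutator {i j : Fin N} (h : i ≠ j) (B : Op1) :
    link i j * siteHom i B - siteHom i B * link i j =
      siteHom i (sigmaX * B - B * sigmaX) * siteHom j sigmaX +
        siteHom i (sigmaY * B - B * sigmaY) * siteHom j sigmaY := by
  simp only [link, add_mul, mul_add, map_sub, map_mul, sub_mul, mul_assoc,
    (siteHom_commute h B _).eq]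
  abel

theorem sigmaZ_mul_link_commutator_sigmaY {i j : Fin N} (h : i ≠ j) :
    siteHom i sigmaZ * (link i j * siteHom i sigmaY - siteHom i sigmaY * link i j) =
      (2 * Complex.I) • siteHom j sigmaX := by
  have hz : sigmaZ * (sigmaX * sigmaY - sigmaY * sigmaX) = (2 * Complex.I) • (1 : Op1) := by
    ext a b
    fin_cases a <;> fin_cases b <;> simp [sigmaX, sigmaY, sigmaZ, Matrix.mul_apply] <;> ring
  rw [link_commutator h, sub_self, map_zero, zero_mul, add_zero, ← mul_assoc, ← map_mul, hz,
    map_smul, map_one, Matrix.smul_mul, one_mul]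

theorem sigmaZ_mul_link_commutator_sigmaX {i j : Fin N} (h : i ≠ j) :
    siteHom i sigmaZ * (link i j * siteHom i sigmaX - siteHom i sigmaX * link i j) =
      (-2 * Complex.I) • siteHom j sigmaY := by
  have hz : sigmaZ * (sigmaY * sigmaX - sigmaX * sigmaY) = (-2 * Complex.I) • (1 : Op1) := by
    ext a b
    fin_cases a <;> fin_cases b <;> simp [sigmaX, sigmaY, sigmaZ, Matrix.mul_apply] <;> ring
  rw [link_commutator h, sub_self, map_zero, zero_mul, zero_add, ← mul_assoc, ← map_mul, hz,
    map_smul, map_one, Matrix.smul_mul, one_mul]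

/-- All terms of the Hamiltonian other than the coupling of `i` to its right neighbour `j` either
lie in `S` or commute with the operators at `i`, so the commutator with that coupling lies in `S`. -/
theorem link_commutator_mem {S : Subalgebra ℂ (Op N)} (hH : hamiltonian N ∈ S) {i j : Fin N}
    (hij : (j : ℕ) = i + 1) (hS : ∀ l : Fin N, l ≤ i → ∀ A, siteHom l A ∈ S) (B : Op1) :
    link i j * siteHom i B - siteHom i B * link i j ∈ S := by
  have hB := hS i le_rfl B
  have hk : (i : ℕ) + 1 ∈ Finset.Ico 1 N := by
    rw [Finset.mem_Ico]
    exact ⟨by omega, by omega⟩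
  have hfield : (∑ k ∈ Finset.Icc 1 N, site N k sigmaZ) * siteHom i B -
      siteHom i B * (∑ k ∈ Finset.Icc 1 N, site N k sigmaZ) ∈ S := by
    rw [Finset.sum_mul, Finset.mul_sum, ← Finset.sum_sub_distrib]
    refine S.sum_mem fun k hk => ?_
    obtain ⟨l, rfl⟩ := exists_fin_of_mem_Icc hk
    rw [site_succ]
    by_cases hl : l = i
    · subst hl
      exact S.sub_mem (S.mul_mem (hS l le_rfl _) hB) (S.mul_mem hB (hS l le_rfl _))
    · rw [(siteHom_commute hl _ _).eq, sub_self]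
      exact S.zero_mem
  have hlinks : ∀ k ∈ (Finset.Ico 1 N).erase (i + 1),
      (site N k sigmaX * site N (k + 1) sigmaX + site N k sigmaY * site N (k + 1) sigmaY) *
        siteHom i B - siteHom i B *
      (site N k sigmaX * site N (k + 1) sigmaX + site N k sigmaY * site N (k + 1) sigmaY) ∈ S := by
    intro k hk
    rw [Finset.mem_erase] at hk
    obtain ⟨l, m, hlm, rfl⟩ := exists_fin_of_mem_Ico hk.2
    have hne : l ≠ i := fun e => hk.1 (by rw [e])
    rw [site_link hlm]
    rcases lt_or_gt_of_ne hne with hl | hl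
    · have hm : m ≤ i := by rw [Fin.le_def, hlm]; exact hl
      have hlink : link l m ∈ S :=
        S.add_mem (S.mul_mem (hS l hl.le _) (hS m hm _)) (S.mul_mem (hS l hl.le _) (hS m hm _))
      exact S.sub_mem (S.mul_mem hlink hB) (S.mul_mem hB hlink)
    · have hm : m ≠ i := fun e => by
        rw [e] at hlm
        have := Fin.lt_def.1 hl
        omega
      have hc : Commute (link l m) (siteHom i B) :=
        ((siteHom_commute hne _ _).mul_left (siteHom_commute hm _ _)).add_left
          ((siteHom_commute hne _ _).mul_left (siteHom_commute hm _ _))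
      rw [hc.eq, sub_self]
      exact S.zero_mem
  have hall := S.sub_mem (S.sub_mem (S.sub_mem (S.mul_mem hH hB) (S.mul_mem hB hH)) hfield)
    (S.sum_mem hlinks)
  rw [Finset.sum_sub_distrib, ← Finset.sum_mul, ← Finset.mul_sum] at hall
  convert hall using 1
  rw [hamiltonian, ← Finset.add_sum_erase _ _ hk, site_link hij]
  noncomm_ring

/-- A subalgebra containing the Hamiltonian and the operators at the first spin contains those at
every spin: the commutators of the Hamiltonian with the operators at one spin produce operators
at the next one. -/
theorem siteHom_mem_of_hamiltonian_mem {S : Subalgebra ℂ (Op N)} (hH : hamiltonian N ∈ S)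
    (hS : ∀ i : Fin N, (i : ℕ) = 0 → ∀ A, siteHom i A ∈ S) (i : Fin N) (A : Op1) :
    siteHom i A ∈ S := by
  have key : ∀ n : ℕ, ∀ i : Fin N, (i : ℕ) ≤ n → ∀ A, siteHom i A ∈ S := by
    intro n
    induction n with
    | zero => exact fun i hi => hS i (Nat.le_zero.1 hi)
    | succ n ih =>
      intro j hj
      rcases Nat.lt_or_ge j (n + 1) with hlt | hge
      · exact ih j (Nat.le_of_lt_succ hlt)
      · obtain ⟨i, hi⟩ : ∃ i : Fin N, (i : ℕ) = n := ⟨⟨n, by omega⟩, rfl⟩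
        have hij : (j : ℕ) = i + 1 := by omega
        have hne : i ≠ j := fun e => by simp [e] at hij
        have hle : ∀ l : Fin N, l ≤ i → ∀ A, siteHom l A ∈ S := fun l hl =>
          ih l (hi ▸ Fin.le_def.1 hl)
        have hx := S.mul_mem (hle i le_rfl sigmaZ) (link_commutator_mem hH hij hle sigmaY)
        have hy := S.mul_mem (hle i le_rfl sigmaZ) (link_commutator_mem hH hij hle sigmaX)
        rw [sigmaZ_mul_link_commutator_sigmaY hne] at hx
        rw [sigmaZ_mul_link_commutator_sigmaX hne] at hy
        refine siteHom_mem_of_sigmaX_mem_of_sigmaY_mem ?_ ?_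
        · have h := S.smul_mem hx (2 * Complex.I)⁻¹
          rwa [inv_smul_smul₀ (by simp)] at h
        · have h := S.smul_mem hy (-2 * Complex.I)⁻¹
          rwa [inv_smul_smul₀ (by simp)] at h
  exact key i i le_rfl A

end Hamiltonian

/-! ### Stationary operators of the chain in equilibrium -/

section Equilibrium

variable {N : ℕ}

theorem masterGenerator_apply (β β' : ℝ) (ρ : Op N) :
    masterGenerator N β β' ρ = -Complex.I • (hamiltonian N * ρ - ρ * hamiltonian N)
      + bathTerm N 1 β ρ + bathTerm N N β' ρ := rfl

theorem exists_fin_first_last (hN : 1 ≤ N) :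
    ∃ i j : Fin N, (i : ℕ) = 0 ∧ (i : ℕ) + 1 = 1 ∧ (j : ℕ) + 1 = N :=
  ⟨⟨0, hN⟩, ⟨N - 1, by omega⟩, rfl, rfl, by simp; omega⟩

/-- The energy form `Tr (X* ρ^β [H_S, X])` is real, because `H_S` is Hermitian and commutes
with `ρ^β`. -/
theorem trace_commutator_im (β : ℝ) (X : Op N) :
    (Xᴴ * (hamiltonian N * (productState N β * X) -
      productState N β * X * hamiltonian N)).trace.im = 0 := by
  have hc := (commute_hamiltonian_productState N β).eq
  have hH := hamiltonian_conjTranspose N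
  have hσ := productState_conjTranspose N β
  rw [← Complex.conj_eq_iff_im, starRingEnd_apply, ← Matrix.trace_conjTranspose]
  generalize hamiltonian N = H at *
  generalize productState N β = σ at *
  simp only [Matrix.conjTranspose_mul, Matrix.conjTranspose_sub, Matrix.conjTranspose_conjTranspose,
    hH, hσ, mul_sub, Matrix.trace_sub]
  congr 1
  · rw [← mul_assoc H, hc]
    simp only [mul_assoc]
  · rw [mul_assoc H, Matrix.trace_mul_comm]
    simp only [mul_assoc]

theorem masterGenerator_productState (hN : 1 ≤ N) (β : ℝ) :
    masterGenerator N β β (productState N β) = 0 := by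
  obtain ⟨i, j, -, hi, hj⟩ := exists_fin_first_last hN
  have h : ∀ l : Fin N, bathTerm N (l + 1) β (productState N β) = 0 := fun l => by
    simpa using bathTerm_eq_zero_of_commute (β := β) (Commute.one_right (siteHom l sigmaPlus))
      (Commute.one_right (siteHom l sigmaMinus))
  have h1 := h i
  have h2 := h j
  rw [hi] at h1
  rw [hj] at h2
  rw [masterGenerator_apply, (commute_hamiltonian_productState N β).eq, h1, h2]
  simp

/-- The kernel of the generator is spanned by the equilibrium state. -/
theorem exists_eq_smul_productState (hN : 1 ≤ N) (β : ℝ) {ρ : Op N}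
    (hρ : masterGenerator N β β ρ = 0) : ∃ c : ℂ, ρ = c • productState N β := by
  obtain ⟨i, j, hi0, hi, hj⟩ := exists_fin_first_last hN
  obtain ⟨X, rfl⟩ : ∃ X, ρ = productState N β * X :=
    (isUnit_productState N β).dvd
  -- The real part of `Tr (X* ℒ*(σ X)) = 0` contains only the two Dirichlet forms.
  have ht := congrArg (fun Z => (Xᴴ * Z).trace.re) hρ
  have hb1 := trace_bathTerm β i X
  have hbN := trace_bathTerm β j X
  rw [hi] at hb1
  rw [hj] at hbN
  simp only [masterGenerator_apply, mul_add, Matrix.mul_smul, Matrix.trace_add, Matrix.trace_smul,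
    hb1, hbN, smul_eq_mul, Complex.add_re, Complex.mul_re, Complex.neg_re, Complex.neg_im,
    Complex.I_re, Complex.I_im, trace_commutator_im, Complex.ofReal_re, mul_zero,
    Matrix.trace_zero, Complex.zero_re] at ht
  have hn1 := dirichletForm_nonneg β i X
  have hnN := dirichletForm_nonneg β j X
  obtain ⟨hp1, hm1⟩ := commute_of_dirichletForm_eq_zero (X := X) (β := β) (i := i) (by linarith)
  obtain ⟨hpN, hmN⟩ := commute_of_dirichletForm_eq_zero (X := X) (β := β) (i := j) (by linarith)
  have hz1 := bathTerm_eq_zero_of_commute (β := β) hp1 hm1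
  have hzN := bathTerm_eq_zero_of_commute (β := β) hpN hmN
  rw [hi] at hz1
  rw [hj] at hzN
  rw [masterGenerator_apply, hz1, hzN, add_zero, add_zero, ← mul_assoc,
    (commute_hamiltonian_productState N β).eq, mul_assoc, mul_assoc, ← mul_sub] at hρ
  have hH : Commute (hamiltonian N) X :=
    sub_eq_zero.1 ((isUnit_productState N β).mul_right_eq_zero.1
      ((smul_eq_zero.1 hρ).resolve_left (neg_ne_zero.2 Complex.I_ne_zero)))
  have hmem : ∀ {Y : Op N}, Y ∈ Subalgebra.centralizer ℂ {X} ↔ Commute Y X := fun {Y} => by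
    rw [Subalgebra.mem_centralizer_iff]
    exact ⟨fun h => (h X rfl).symm, fun h Z hZ => by rw [Set.mem_singleton_iff.1 hZ, h.eq]⟩
  -- The commutant of `X` contains the Hamiltonian and the first spin, hence every spin.
  obtain ⟨c, rfl⟩ := exists_eq_smul_one_of_forall_commute_siteHom (X := X) fun l A =>
    hmem.1 (siteHom_mem_of_hamiltonian_mem (hmem.2 hH) (fun l hl A => by
      obtain rfl : l = i := Fin.ext (hl.trans hi0.symm)
      exact siteHom_mem_of_sigmaPlus_mem_of_sigmaMinus_mem (hmem.2 hp1) (hmem.2 hm1) A) l A)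
  exact ⟨c, by rw [Matrix.mul_smul, mul_one]⟩

end Equilibrium

end SpinChain

theorem theorem3p2 (N : ℕ) (hN : 1 ≤ N) (β β' : ℝ) (hβ : β = β') :
    SpinChain.IsState (SpinChain.productState N β) ∧
    SpinChain.IsFaithful (SpinChain.productState N β) ∧
    SpinChain.masterGenerator N β β' (SpinChain.productState N β) = 0 ∧
    SpinChain.IsStationary N β β' (SpinChain.productState N β) ∧
    ∀ ρ : SpinChain.Op N, SpinChain.IsState ρ → SpinChain.IsStationary N β β' ρ →
      ρ = SpinChain.productState N β := by
  subst hβ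
  have h0 := SpinChain.masterGenerator_productState hN β
  refine ⟨SpinChain.productState_isState N β, SpinChain.productState_isFaithful N β, h0,
    (SpinChain.isStationary_iff N β β _).2 h0, fun ρ hρ hst => ?_⟩
  obtain ⟨c, rfl⟩ :=
    SpinChain.exists_eq_smul_productState hN β ((SpinChain.isStationary_iff N β β ρ).1 hst)
  have hc := hρ.2
  rw [Matrix.trace_smul, (SpinChain.productState_isState N β).2, smul_eq_mul, mul_one] at hc
  rw [hc, one_smul]
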